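/- Let $\mathbb{D}$ be the unit disc of $\mathbb{C}$ and $dA=\frac{dx\,dy}{\pi}$. A radial weight is an integrable function $\omega:\mathbb{D}\to[0,\infty)$ with $\omega(z)=\omega(|z|)$; put $\widehat\omega(t)=\int_t^1\omega(s)\,ds$. Write $\omega\in\widehat{\mathcal D}$ if $\omega$ is a radial weight with $\widehat\omega(t)>0$ for all $0\le t<1$ and there is $C\ge1$ such that $\widehat\omega(t)\le C\,\widehat\omega(\frac{1+t}{2})$ for all $0\le t<1$. For $0<p<\infty$, the Bergman space $A^p_\omega$ consists of the analytic functions $f$ in $\mathbb{D}$ with $\|f\|_{A^p_\omega}^p=\int_{\mathbb{D}}|f|^p\omega\,dA<\infty$. A measurable set $G\subset\mathbb{D}$ is a dominating set for $f\in A^p_\omega$ if there is $\delta>0$ such that $\int_G|f|^p\omega\,dA\ge\delta\|f\|^p_{A^p_\omega}$. Let $\Delta(z,r)=\{\zeta\in\mathbb{D}:|\frac{z-\zeta}{1-\overline{z}\zeta}|<r\}$ be the pseudohyperbolic disc. Let $\omega\in\widehat{\mathcal D}$ and $0<r<1$. For $0<p<\infty$, $f\in A^p_\omega$, $\varepsilon>0$,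 a positive Borel measure $\nu$ on $\mathbb{D}$ and measurable sets $E(z)\subset\Delta(z,r)$ with $\nu(E(z))>0$ for all $z\in\mathbb{D}$, define $$Q(f)(z)=\frac{1}{\nu(E(z))}\int_{E(z)}|f(\zeta)|^p\,d\nu(\zeta),\qquad E=\{z\in\mathbb{D}:|f(z)|^p\le\varepsilon\,Q(f)(z)\},$$ with the conventions $1/\infty=0$ and $0\cdot\infty=0$, and suppose that $E$ is measurable. Then there exists a constant $C=C(r,\omega)>0$, depending only on $r$ and $\omega$, such that $$\int_E|f(z)|^p\omega(z)\,dA(z)\le C\varepsilon\|f\|^p_{A^p_\omega}$$ for all such $p$, $f$, $\varepsilon$, $\nu$ and $E(\cdot)$. Moreover, there exists $\varepsilon_0=\varepsilon_0(r,\omega)>0$ such that, whenever $0<\varepsilon\le\varepsilon_0$, the set $\mathbb{D}\setminus E$ is a dominating set for $f$. -/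

import Mathlib

open MeasureTheory
open scoped ENNReal

noncomputable section

namespace WeightedBergman

/-- The open unit disc. -/
def unitDisc : Set ℂ := Metric.ball 0 1

/-- The normalized area measure `dA = dx dy / π` on the unit disc. -/
def discArea : Measure ℂ :=
  ENNReal.ofReal (Real.pi⁻¹) • (volume : Measure ℂ).restrict unitDisc

/-- A weight: a nonnegative integrable function on the unit disc. Functions on the disc are
represented by functions on `ℂ` whose values outside the disc are irrelevant. -/
structure IsWeight (ω : ℂ → ℝ) : Prop where
  nonneg : ∀ z ∈ unitDisc, 0 ≤ ω z
  integrable : Integrable ω discArea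

/-- A weight is radial if `ω z = ω |z|` on the disc. -/
def IsRadial (ω : ℂ → ℝ) : Prop :=
  ∀ z ∈ unitDisc, ω z = ω (‖z‖ : ℂ)

/-- The tail `ω̂(t) = ∫_t^1 ω(s) ds` of a radial weight, with values in `[0, ∞]`. -/
def tail (ω : ℂ → ℝ) (t : ℝ) : ℝ≥0∞ :=
  ∫⁻ s in Set.Ioo t 1, ENNReal.ofReal (ω (s : ℂ))

/-- The class `D̂` of radial weights with positive tail such that
`ω̂(t) ≤ C ω̂((1+t)/2)` for all `0 ≤ t < 1`. -/
structure MemDHat (ω : ℂ → ℝ) : Prop where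
  isWeight : IsWeight ω
  isRadial : IsRadial ω
  tail_pos : ∀ t : ℝ, 0 ≤ t → t < 1 → 0 < tail ω t
  doubling : ∃ C : ℝ, 1 ≤ C ∧
    ∀ t : ℝ, 0 ≤ t → t < 1 → tail ω t ≤ ENNReal.ofReal C * tail ω ((1 + t) / 2)

/-- `∫_G |f|^p ω dA`, with values in `[0, ∞]`; only the part of `G` in the disc matters. -/
def integralOver (p : ℝ) (ω : ℂ → ℝ) (f : ℂ → ℂ) (G : Set ℂ) : ℝ≥0∞ :=
  ∫⁻ z in G, ‖f z‖ₑ ^ p * ENNReal.ofReal (ω z) ∂discArea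

/-- The `p`-th power `‖f‖^p` of the Bergman norm. -/
def normPow (p : ℝ) (ω : ℂ → ℝ) (f : ℂ → ℂ) : ℝ≥0∞ :=
  integralOver p ω f unitDisc

/-- Membership in the weighted Bergman space `A^p_ω`. -/
structure MemBergman (p : ℝ) (ω : ℂ → ℝ) (f : ℂ → ℂ) : Prop where
  analytic : DifferentiableOn ℂ f unitDisc
  norm_finite : normPow p ω f < ∞

/-- The pseudohyperbolic disc `Δ(z, r)`. -/
def pseudoDisc (z : ℂ) (r : ℝ) : Set ℂ :=
  {w ∈ unitDisc | ‖(z - w) / (1 - (starRingEnd ℂ) z * w)‖ < r}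

/-- Measurable sets `S z ⊆ Δ(z, r)`, `z` in the disc, with `ν (S z) > 0`. -/
structure IsAveragingFamily (r : ℝ) (ν : Measure ℂ) (S : ℂ → Set ℂ) : Prop where
  measurable : ∀ z ∈ unitDisc, NullMeasurableSet (S z) ν
  subset : ∀ z ∈ unitDisc, S z ⊆ pseudoDisc z r
  pos : ∀ z ∈ unitDisc, 0 < ν (S z)

/-- `Q(f)(z)`, the `ν`-average of `|f|^p` over `S z`. -/
def average (p : ℝ) (ν : Measure ℂ) (S : ℂ → Set ℂ) (f : ℂ → ℂ) (z : ℂ) : ℝ≥0∞ :=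
  (ν (S z))⁻¹ * ∫⁻ ζ in S z, ‖f ζ‖ₑ ^ p ∂ν

/-- The set of the points `z` of the disc with `|f(z)|^p ≤ ε Q(f)(z)`. -/
def badSet (p : ℝ) (ν : Measure ℂ) (S : ℂ → Set ℂ) (ε : ℝ) (f : ℂ → ℂ) : Set ℂ :=
  {z ∈ unitDisc | ‖f z‖ₑ ^ p ≤ ENNReal.ofReal ε * average p ν S f z}

/-- `G` is a dominating set for `f ∈ A^p_ω`: a (Lebesgue) measurable subset of the disc with
`∫_G |f|^p ω dA ≥ δ ‖f‖^p` for some `δ > 0`. -/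
structure IsDominatingFor (p : ℝ) (ω : ℂ → ℝ) (f : ℂ → ℂ) (G : Set ℂ) : Prop where
  subset : G ⊆ unitDisc
  measurable : NullMeasurableSet G (volume : Measure ℂ)
  bound : ∃ δ : ℝ, 0 < δ ∧ ENNReal.ofReal δ * normPow p ω f ≤ integralOver p ω f G

end WeightedBergman

end

namespace WeightedBergman

open Metric Set Real Filter Topology

-- The average `Q(f)(z)` is dominated by a quantity that knows nothing of `ν` or `E(z)`. Every point
-- of `Δ(z, r)` is the centre of a disc of radius `κ (1 - |z|)` that stays inside a fixed multiple
-- of that scale around `z` and at distance at least `κ (1 - |z|)` from the unit circle. Since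
-- `|f|^p` is subharmonic, `|f|^p ≤ localMean` throughout `Δ(z, r)`, hence `Q(f)(z) ≤ localMean`
-- (`average_le_localMean`). On the bad set `|f|^p ≤ ε localMean`, so it remains to bound the
-- `ω`-integral of `localMean` by `‖f‖^p`, with a constant free of `p` and `f`.
--
-- As `ω` is radial, only circular means matter. Rotating and exchanging integrals, the mean of
-- `localMean` over `|z| = s` is at most a constant times the integral mean of `|f|^p` at radius `1
-- - κ (1 - s)`, because integral means increase with the radius (`circleAverage_norm_rpow_mono`).
-- With `κ = 2^{-n}` that radius arises from `s` by `n` steps `s ↦ (1 + s) / 2`, and each step costs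
-- a bounded factor by doubling of the tail (`lintegral_comp_halfway_le`): superlevel sets of an
-- increasing function are intervals ending at 1. Taking `C ε ≤ 1/2` leaves at least half of the
-- norm off the bad set.

-- Sub-mean value property and polar coordinates.

/-- The `p`-th power of the modulus of an analytic function has the sub-mean value property. -/
theorem norm_rpow_le_circleAverage {f : ℂ → ℂ} {c : ℂ} {R p : ℝ} (hR : 0 < R) (hp : 0 < p)
    (hf : AnalyticOnNhd ℂ f (closedBall c R)) :
    ‖f c‖ ^ p ≤ circleAverage (fun z => ‖f z‖ ^ p) c R := by
  have hcont : ContinuousOn (fun z => ‖f z‖ ^ p) (sphere c R) :=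
    ((hf.continuousOn.mono sphere_subset_closedBall).norm).rpow_const fun _ _ => Or.inr hp.le
  rcases eq_or_ne (f c) 0 with h0 | h0
  · rw [h0, norm_zero, zero_rpow hp.ne']
    exact circleAverage_nonneg_of_nonneg fun _ _ => by positivity
  have hR' : |R| = R := abs_of_pos hR
  have hlogint : CircleIntegrable (fun z => Real.log ‖f z‖) c R :=
    MeromorphicOn.circleIntegrable_log_norm
      ((hf.mono (by rw [hR']; exact sphere_subset_closedBall)).meromorphicOn)
  -- Jensen's formula: the mean exceeds `log |f(c)|` by the sum of `log (R / |z - c|)` over the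
  -- zeros, and each term is nonnegative.
  have hlog : Real.log ‖f c‖ ≤ circleAverage (fun z => Real.log ‖f z‖) c R := by
    have := AnalyticOnNhd.circleAverage_log_norm hR.ne' (by rwa [hR']) h0
    rw [this]
    refine le_add_of_nonneg_left (finsum_nonneg fun z => ?_)
    by_cases hz : z ∈ closedBall c |R|
    · refine mul_nonneg ?_ ?_
      · exact_mod_cast MeromorphicOn.AnalyticOnNhd.divisor_nonneg (by rwa [hR']) z
      · rcases eq_or_ne z c with rfl | hzc
        · simp
        refine Real.log_nonneg ?_
        rw [hR', mem_closedBall, dist_comm, dist_eq_norm] at hz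
        rw [← div_eq_mul_inv, one_le_div (norm_pos_iff.2 (sub_ne_zero.2 hzc.symm))]
        exact hz
    · simp [hz]
  -- At a zero `Real.log 0 = 0` makes the right side 1 instead of 0, so the two agree only off the
  -- zeros, which are isolated.
  have hae : (fun z => ‖f z‖ ^ p) =ᶠ[codiscreteWithin (sphere c |R|)]
      fun z => Real.exp (p * Real.log ‖f z‖) := by
    have hne : ∀ᶠ z in codiscreteWithin (closedBall c R), f z ≠ 0 := by
      have := hf.preimage_zero_mem_codiscreteWithin (x := c) h0
        (by simp [hR.le]) ⟨⟨c, by simp [hR.le]⟩, (convex_closedBall c R).isPreconnected⟩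
      filter_upwards [this] with z hz
      simpa using hz
    have hne' := Filter.codiscreteWithin_mono
      (show sphere c |R| ⊆ closedBall c R by rw [hR']; exact sphere_subset_closedBall) hne
    filter_upwards [hne'] with z hz
    rw [Real.rpow_def_of_pos (norm_pos_iff.2 hz), mul_comm]
  have hexpint : CircleIntegrable (fun z => Real.exp (p * Real.log ‖f z‖)) c R := by
    refine (circleIntegrable_congr_codiscreteWithin hae).1 ?_
    exact hcont.circleIntegrable hR.le
  -- Jensen's inequality for `exp` turns the bound on the mean of `p log |f|` into one on the mean
  -- of `|f|^p`.
  have hJ : Real.exp (circleAverage (fun z => p * Real.log ‖f z‖) c R) ≤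
      circleAverage (fun z => Real.exp (p * Real.log ‖f z‖)) c R := by
    rw [circleAverage_eq_intervalAverage, circleAverage_eq_intervalAverage]
    have h1 : IntegrableOn (fun θ => p * Real.log ‖f (circleMap c R θ)‖) (uIoc 0 (2 * π)) := by
      have := hlogint.const_mul p
      exact intervalIntegrable_iff.1 this
    have h2 := intervalIntegrable_iff.1 hexpint
    refine convexOn_exp.map_set_average_le Real.continuous_exp.continuousOn isClosed_univ
      ?_ ?_ (by simp) h1 h2
    · simp [uIoc, two_pi_pos.le, pi_pos]
    · simp [uIoc, two_pi_pos.le, ENNReal.mul_eq_top]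
  rw [circleAverage_congr_codiscreteWithin hae hR.ne']
  refine le_trans ?_ hJ
  rw [Real.rpow_def_of_pos (norm_pos_iff.2 h0)]
  refine Real.exp_le_exp.2 ?_
  have : circleAverage (fun z => p * Real.log ‖f z‖) c R
      = p * circleAverage (fun z => Real.log ‖f z‖) c R := by
    simpa [smul_eq_mul] using
      (circleAverage_fun_smul (a := p) (f := fun z => Real.log ‖f z‖) (c := c) (R := R))
  rw [this, mul_comm]
  exact mul_le_mul_of_nonneg_left hlog hp.le

/-- Circular Lebesgue integrals of continuous nonnegative functions are circle averages. -/
theorem lintegral_circleMap_eq {u : ℂ → ℝ} {c : ℂ} {R : ℝ} (hu : ContinuousOn u (sphere c |R|))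
    (h0 : ∀ z ∈ sphere c |R|, 0 ≤ u z) (α : ℝ) :
    ∫⁻ θ in Ioo (-π) π, ENNReal.ofReal (u (circleMap c R (θ + α)))
      = ENNReal.ofReal (2 * π * circleAverage u c R) := by
  have hc : Continuous fun θ => u (circleMap c R θ) :=
    hu.comp_continuous (continuous_circleMap c R) fun θ => circleMap_mem_sphere' c R θ
  have hper : Function.Periodic (fun θ => u (circleMap c R θ)) (2 * π) :=
    fun θ => by simp [periodic_circleMap c R θ]
  have h1 : ∫ θ in Ioo (-π) π, u (circleMap c R (θ + α)) = 2 * π * circleAverage u c R := by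
    rw [← integral_Ioc_eq_integral_Ioo,
      ← intervalIntegral.integral_of_le (by linarith [pi_pos]),
      intervalIntegral.integral_comp_add_right (fun θ => u (circleMap c R θ)),
      show π + α = (-π + α) + 2 * π by ring, hper.intervalIntegral_add_eq (-π + α) 0,
      circleAverage_def, smul_eq_mul, zero_add, ← mul_assoc,
      mul_inv_cancel₀ two_pi_pos.ne', one_mul]
  rw [← h1, ofReal_integral_eq_lintegral_ofReal]
  · have : Continuous fun θ => u (circleMap c R (θ + α)) := hc.comp (by fun_prop)
    exact (this.integrableOn_Icc (a := -π) (b := π)).mono_set Ioo_subset_Icc_self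
  · exact Eventually.of_forall fun θ => h0 _ (circleMap_mem_sphere' c R _)

/-- Integration in polar coordinates around a point. -/
theorem setLIntegral_polar (c : ℂ) (g : ℂ → ℝ≥0∞) :
    ∫⁻ q in Ioi (0 : ℝ) ×ˢ Ioo (-π) π, ENNReal.ofReal q.1 * g (circleMap c q.1 q.2)
      = ∫⁻ z, g z := by
  rw [← lintegral_add_left_eq_self g c, ← Complex.lintegral_comp_polarCoord_symm]
  change _ = ∫⁻ q in Ioi (0 : ℝ) ×ˢ Ioo (-π) π, _
  refine lintegral_congr fun q => ?_
  rw [smul_eq_mul, Complex.polarCoord_symm_apply, circleMap, Complex.exp_mul_I]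
  simp

/-- One half of Tonelli holds for arbitrary `g`; this is why no measurability of `localMean` or of
its product with the weight is needed. -/
theorem lintegral_le_polar (c : ℂ) (g : ℂ → ℝ≥0∞) :
    ∫⁻ z, g z ≤ ∫⁻ s in Ioi (0 : ℝ), ENNReal.ofReal s *
      ∫⁻ θ in Ioo (-π) π, g (circleMap c s θ) := by
  rw [← setLIntegral_polar c g, Measure.volume_eq_prod, ← Measure.prod_restrict]
  refine (lintegral_prod_le _).trans_eq (lintegral_congr fun s => ?_)
  rw [lintegral_const_mul' _ _ ENNReal.ofReal_ne_top]

theorem lintegral_eq_polar (c : ℂ) {g : ℂ → ℝ≥0∞} (hg : Measurable g) :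
    ∫⁻ z, g z = ∫⁻ s in Ioi (0 : ℝ), ENNReal.ofReal s *
      ∫⁻ θ in Ioo (-π) π, g (circleMap c s θ) := by
  rw [← setLIntegral_polar c g, Measure.volume_eq_prod, ← Measure.prod_restrict,
    lintegral_prod]
  · refine lintegral_congr fun s => ?_
    rw [lintegral_const_mul' _ _ ENNReal.ofReal_ne_top]
  · have : Measurable fun q : ℝ × ℝ => circleMap c q.1 q.2 :=
      circleMap.continuous.measurable
    fun_prop

theorem enorm_rpow_eq {f : ℂ → ℂ} {p : ℝ} (hp : 0 < p) (z : ℂ) :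
    ‖f z‖ₑ ^ p = ENNReal.ofReal (‖f z‖ ^ p) := by
  rw [← ofReal_norm, ENNReal.ofReal_rpow_of_nonneg (norm_nonneg _) hp.le]

theorem measurable_indicator_enorm_rpow {f : ℂ → ℂ} {p : ℝ} {U : Set ℂ} (hU : IsOpen U)
    (hf : DifferentiableOn ℂ f U) : Measurable (U.indicator fun z => ‖f z‖ₑ ^ p) := by
  have hcont : ContinuousOn (fun z => ‖f z‖ₑ ^ p) U :=
    ENNReal.continuous_rpow_const.comp_continuousOn hf.continuousOn.enorm
  classical
  rw [← piecewise_eq_indicator]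
  exact hcont.measurable_piecewise continuousOn_const hU.measurableSet

/-- The sub-mean value property over discs. -/
theorem enorm_rpow_le_lintegral_ball {f : ℂ → ℂ} {c : ℂ} {R p : ℝ} (hR : 0 < R) (hp : 0 < p)
    (hf : DifferentiableOn ℂ f (ball c R)) :
    ENNReal.ofReal (π * R ^ 2) * ‖f c‖ₑ ^ p ≤ ∫⁻ z in ball c R, ‖f z‖ₑ ^ p := by
  have han := hf.analyticOnNhd isOpen_ball
  rw [← lintegral_indicator isOpen_ball.measurableSet,
    lintegral_eq_polar c (measurable_indicator_enorm_rpow isOpen_ball hf)]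
  have key : ∀ s ∈ Ioo 0 R, ENNReal.ofReal s * (ENNReal.ofReal (2 * π) * ‖f c‖ₑ ^ p) ≤
      ENNReal.ofReal s * ∫⁻ θ in Ioo (-π) π,
        (ball c R).indicator (fun z => ‖f z‖ₑ ^ p) (circleMap c s θ) := by
    intro s hs
    gcongr
    have hsub : closedBall c s ⊆ ball c R := closedBall_subset_ball hs.2
    have hsph : sphere c |s| ⊆ ball c R := by
      rw [abs_of_pos hs.1]; exact sphere_subset_closedBall.trans hsub
    have h1 := norm_rpow_le_circleAverage hs.1 hp (han.mono hsub)
    have h2 := lintegral_circleMap_eq (u := fun z => ‖f z‖ ^ p) (c := c) (R := s)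
      ((hf.continuousOn.mono hsph).norm.rpow_const fun _ _ => Or.inr hp.le)
      (fun _ _ => by positivity) 0
    calc ENNReal.ofReal (2 * π) * ‖f c‖ₑ ^ p
        ≤ ENNReal.ofReal (2 * π * circleAverage (fun z => ‖f z‖ ^ p) c s) := by
          rw [enorm_rpow_eq hp, ← ENNReal.ofReal_mul two_pi_pos.le]
          gcongr
      _ = _ := by
          rw [← h2]
          refine lintegral_congr fun θ => ?_
          rw [indicator_of_mem (hsph (circleMap_mem_sphere' c s θ)), enorm_rpow_eq hp, add_zero]
  calc ENNReal.ofReal (π * R ^ 2) * ‖f c‖ₑ ^ p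
      = ∫⁻ s in Ioo 0 R, ENNReal.ofReal s * (ENNReal.ofReal (2 * π) * ‖f c‖ₑ ^ p) := by
        rw [lintegral_mul_const _ (by fun_prop), ← ofReal_integral_eq_lintegral_ofReal,
          ← integral_Ioc_eq_integral_Ioo, ← intervalIntegral.integral_of_le hR.le, integral_id,
          ← mul_assoc, ← ENNReal.ofReal_mul (by nlinarith)]
        · congr 2; ring
        · exact (continuous_id.integrableOn_Icc (a := 0) (b := R)).mono_set Ioo_subset_Icc_self
        · exact (ae_restrict_mem measurableSet_Ioo).mono fun s hs => hs.1.le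
    _ ≤ ∫⁻ s in Ioo 0 R, ENNReal.ofReal s * ∫⁻ θ in Ioo (-π) π,
        (ball c R).indicator (fun z => ‖f z‖ₑ ^ p) (circleMap c s θ) :=
      setLIntegral_mono' measurableSet_Ioo key
    _ ≤ _ := lintegral_mono_set Ioo_subset_Ioi_self

-- Growth of integral means.

/-- The integral means of `|f|^p` over centred circles increase with the radius. -/
theorem circleAverage_norm_rpow_mono {f : ℂ → ℂ} {p : ℝ} (hp : 0 < p)
    (hf : DifferentiableOn ℂ f unitDisc) :
    MonotoneOn (circleAverage (fun z => ‖f z‖ ^ p) 0) (Ico 0 1) := by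
  have hucont : ContinuousOn (fun z => ‖f z‖ ^ p) unitDisc :=
    hf.continuousOn.norm.rpow_const fun _ _ => Or.inr hp.le
  set u : ℂ → ℝ := fun z => ‖f z‖ ^ p with hu
  set V := circleAverage u 0 with hV
  have hVcont : ContinuousOn V (Ico 0 1) := by
    refine ContinuousOn.circleAverage (hucont.mono ?_) fun r hr => hr.1
    intro z hz
    simpa [unitDisc] using hz.2
  have hrot : ∀ w ∈ unitDisc, V ‖w‖ = (2 * π)⁻¹ * ∫ φ in 0..2 * π, u (w * circleMap 0 1 φ) := by
    intro w hw
    rw [hV, circleAverage_eq_integral_add w.arg, smul_eq_mul]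
    congr 2
    ext φ
    congr 1
    conv_rhs => rw [← Complex.norm_mul_exp_arg_mul_I w]
    simp only [circleMap, zero_add, Complex.ofReal_add, Complex.ofReal_one, one_mul, add_mul,
      Complex.exp_add]
    ring
  -- By `hrot`, `w ↦ V ‖w‖` is an average of rotated copies of `|f|^p`, so it inherits their
  -- sub-mean value property.
  have hsub : ∀ c : ℂ, ∀ η : ℝ, 0 < η → ‖c‖ + η < 1 →
      V ‖c‖ ≤ (2 * π)⁻¹ * ∫ θ in 0..2 * π, V ‖circleMap c η θ‖ := by
    intro c η hη hcη
    have hball : ∀ θ, circleMap c η θ ∈ unitDisc := fun θ => by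
      rw [unitDisc, mem_ball_zero_iff]
      refine lt_of_le_of_lt ?_ hcη
      refine (norm_add_le _ _).trans ?_
      simp [abs_of_pos hη]
    have hball' : ∀ θ φ, circleMap c η θ * circleMap 0 1 φ ∈ unitDisc := fun θ φ => by
      have := hball θ
      rw [unitDisc, mem_ball_zero_iff] at this ⊢
      simpa using this
    have hjoint : Continuous (Function.uncurry fun φ θ : ℝ =>
        u (circleMap c η θ * circleMap 0 1 φ)) := by
      refine hucont.comp_continuous (f := fun q : ℝ × ℝ =>
        circleMap c η q.2 * circleMap 0 1 q.1) (by fun_prop) fun q => hball' q.2 q.1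
    simp_rw [fun θ => hrot _ (hball θ)]
    rw [hrot c (by rw [unitDisc, mem_ball_zero_iff]; linarith), intervalIntegral.integral_const_mul]
    refine mul_le_mul_of_nonneg_left ?_ (by positivity)
    have hpt : ∀ φ, u (c * circleMap 0 1 φ) ≤
        (2 * π)⁻¹ * ∫ θ in 0..2 * π, u (circleMap c η θ * circleMap 0 1 φ) := by
      intro φ
      have := norm_rpow_le_circleAverage (f := fun z => f (z * circleMap 0 1 φ)) (c := c) hη hp ?_
      · simpa [circleAverage_def] using this
      · refine DifferentiableOn.analyticOnNhd (s := unitDisc) ?_ isOpen_ball |>.mono ?_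
        · refine hf.comp (by fun_prop) fun z hz => ?_
          rw [unitDisc, mem_ball_zero_iff] at hz ⊢
          simpa using hz
        · refine (closedBall_subset_ball' ?_)
          rw [dist_zero_right]; linarith
    have hci : Continuous fun φ => ∫ θ in 0..2 * π, u (circleMap c η θ * circleMap 0 1 φ) :=
      intervalIntegral.continuous_parametric_intervalIntegral_of_continuous'
        hjoint _ _
    calc ∫ φ in 0..2 * π, u (c * circleMap 0 1 φ)
        ≤ ∫ φ in 0..2 * π, (2 * π)⁻¹ * ∫ θ in 0..2 * π, u (circleMap c η θ * circleMap 0 1 φ) := by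
          refine intervalIntegral.integral_mono_on two_pi_pos.le ?_ ?_ fun φ _ => hpt φ
          · refine (hucont.comp_continuous (by fun_prop) fun φ => ?_).intervalIntegrable _ _
            rw [unitDisc, mem_ball_zero_iff]
            simp; linarith
          · exact (hci.const_mul _).intervalIntegrable _ _
      _ = _ := by
          rw [intervalIntegral.integral_const_mul]
          congr 1
          refine intervalIntegral_intervalIntegral_swap
            (F := fun φ θ => u (circleMap c η θ * circleMap 0 1 φ)) ?_
          rw [uIoc_of_le two_pi_pos.le]
          exact (hjoint.continuousOn.integrableOn_compact
            (isCompact_Icc.prod isCompact_Icc)).mono_set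
            (prod_mono Ioc_subset_Icc_self Ioc_subset_Icc_self)
  intro s hs t ht hst
  -- Maximum principle: if `V t < V s`, the maximum of `V` on `[0, t]` is attained at some `m < t`.
  -- The circle about `m` of radius `t - m` stays in `|w| ≤ t` and touches `|w| = t` at angle 0,
  -- where `V` is strictly smaller, so its mean falls below `V m`.
  by_contra! hlt
  obtain ⟨m, hm, hmax⟩ := isCompact_Icc.exists_isMaxOn (nonempty_Icc.2 ht.1)
    (hVcont.mono fun x hx => (⟨hx.1, hx.2.trans_lt ht.2⟩ : x ∈ Ico (0 : ℝ) 1))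
  have hmt : V t < V m := hlt.trans_le (hmax ⟨hs.1, hst⟩)
  have hmt' : m < t := lt_of_le_of_ne hm.2 (by rintro rfl; exact lt_irrefl _ hmt)
  have hη : 0 < t - m := by linarith
  have hnorm : ∀ θ, ‖circleMap (m : ℂ) (t - m) θ‖ ≤ t := fun θ => by
    refine (norm_add_le _ _).trans ?_
    rw [show ((t - m : ℝ) : ℂ) * Complex.exp (θ * Complex.I) = circleMap 0 (t - m) θ by
        rw [circleMap_zero], norm_circleMap_zero, Complex.norm_real, norm_eq_abs,
      abs_of_nonneg hm.1, abs_of_pos hη]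
    linarith
  have h1 := hsub m (t - m) hη (by simp [abs_of_nonneg hm.1]; exact ht.2)
  have hm' : ‖(m : ℂ)‖ = m := by simp [abs_of_nonneg hm.1]
  rw [hm'] at h1
  have h2 : ∫ θ in 0..2 * π, V ‖circleMap (m : ℂ) (t - m) θ‖ < ∫ θ in 0..2 * π, V m := by
    refine intervalIntegral.integral_lt_integral_of_continuousOn_of_le_of_exists_lt two_pi_pos
      ?_ continuousOn_const ?_ ⟨0, ⟨le_rfl, two_pi_pos.le⟩, ?_⟩
    · refine (hVcont.comp_continuous (by fun_prop) fun θ => ?_).continuousOn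
      exact ⟨norm_nonneg _, (hnorm θ).trans_lt ht.2⟩
    · exact fun θ _ => hmax ⟨norm_nonneg _, hnorm θ⟩
    · have : ‖circleMap (m : ℂ) (t - m) 0‖ = t := by
        simp only [circleMap, Complex.ofReal_zero, zero_mul, Complex.exp_zero, mul_one]
        rw [← Complex.ofReal_add, Complex.norm_real, norm_eq_abs, add_sub_cancel,
          abs_of_nonneg ht.1]
      rwa [this]
  rw [intervalIntegral.integral_const, sub_zero, smul_eq_mul] at h2
  have h3 := mul_lt_mul_of_pos_left h2 (inv_pos.2 two_pi_pos)
  rw [← mul_assoc, inv_mul_cancel₀ two_pi_pos.ne', one_mul] at h3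
  linarith

theorem norm_lt_one_of_mem {z : ℂ} (hz : z ∈ unitDisc) : ‖z‖ < 1 := mem_ball_zero_iff.1 hz

theorem measurableSet_unitDisc : MeasurableSet unitDisc := measurableSet_ball

-- Pseudohyperbolic geometry and local integrals.

/-- Points of a pseudohyperbolic disc have comparable distances to the unit circle, and their
mutual distance is controlled by it. -/
theorem pseudoDisc_estimates {z ζ : ℂ} {r : ℝ} (hr₀ : 0 < r) (hr₁ : r < 1) (hz : z ∈ unitDisc)
    (hζ : ζ ∈ pseudoDisc z r) :
    ‖ζ - z‖ ≤ 2 * r / (1 - r) * (1 - ‖z‖) ∧ (1 - r ^ 2) / 8 * (1 - ‖z‖) ≤ 1 - ‖ζ‖ := by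
  obtain ⟨hζ₁, hζr⟩ := hζ
  have hz1 := norm_lt_one_of_mem hz
  have hζ1 := norm_lt_one_of_mem hζ₁
  have hz0 := norm_nonneg z
  have hζ0 := norm_nonneg ζ
  have hid : ‖1 - (starRingEnd ℂ) z * ζ‖ ^ 2 - ‖z - ζ‖ ^ 2
      = (1 - ‖z‖ ^ 2) * (1 - ‖ζ‖ ^ 2) := by
    simp only [Complex.sq_norm, Complex.normSq_apply, Complex.sub_re, Complex.sub_im,
      Complex.mul_re, Complex.mul_im, Complex.one_re, Complex.one_im, Complex.conj_re,
      Complex.conj_im]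
    ring
  have hlow : 1 - ‖z‖ ≤ ‖1 - (starRingEnd ℂ) z * ζ‖ := by
    have h := norm_sub_norm_le (1 : ℂ) ((starRingEnd ℂ) z * ζ)
    rw [norm_one, norm_mul, RCLike.norm_conj] at h
    nlinarith
  have hup : ‖1 - (starRingEnd ℂ) z * ζ‖ ≤ 2 * (1 - ‖z‖) + ‖z - ζ‖ := by
    have h1 : 1 - (starRingEnd ℂ) z * ζ
        = ((1 - ‖z‖ ^ 2 : ℝ) : ℂ) + (starRingEnd ℂ) z * (z - ζ) := by
      have : (starRingEnd ℂ) z * z = ((‖z‖ ^ 2 : ℝ) : ℂ) := by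
        rw [← Complex.normSq_eq_norm_sq, Complex.normSq_eq_conj_mul_self]
      rw [mul_sub, this]; push_cast; ring
    rw [h1]
    refine (norm_add_le _ _).trans ?_
    rw [norm_mul, RCLike.norm_conj, Complex.norm_real, norm_eq_abs,
      abs_of_nonneg (by nlinarith)]
    nlinarith [norm_nonneg (z - ζ)]
  set a := ‖1 - (starRingEnd ℂ) z * ζ‖ with ha
  set d := ‖z - ζ‖ with hd
  have hd0 : 0 ≤ d := norm_nonneg _
  have ha0 : 0 < a := by linarith
  have hda : d < r * a := by
    rwa [norm_div, div_lt_iff₀ ha0] at hζr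
  constructor
  · rw [norm_sub_rev, ← hd, div_mul_eq_mul_div, le_div_iff₀ (by linarith)]
    nlinarith
  · have h1 : (1 - r ^ 2) * a ^ 2 ≤ (1 - ‖z‖ ^ 2) * (1 - ‖ζ‖ ^ 2) := by
      have : d ^ 2 ≤ (r * a) ^ 2 := pow_le_pow_left₀ hd0 hda.le 2
      nlinarith
    have h2 : (1 - r ^ 2) * (1 - ‖z‖) ^ 2 ≤ (1 - r ^ 2) * a ^ 2 := by
      refine mul_le_mul_of_nonneg_left (pow_le_pow_left₀ (by linarith) hlow 2) (by nlinarith)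
    have h3 : (1 - ‖z‖ ^ 2) * (1 - ‖ζ‖ ^ 2) ≤ 4 * ((1 - ‖z‖) * (1 - ‖ζ‖)) := by
      have h4 : 0 ≤ (1 - ‖z‖) * (1 - ‖ζ‖) := mul_nonneg (by linarith) (by linarith)
      have h5 : (1 + ‖z‖) * (1 + ‖ζ‖) ≤ 4 := by nlinarith
      nlinarith [mul_le_mul_of_nonneg_left h5 h4]
    have h6 : (1 - r ^ 2) * (1 - ‖z‖) ≤ 4 * (1 - ‖ζ‖) := by
      have h7 : (1 - ‖z‖) * ((1 - r ^ 2) * (1 - ‖z‖)) ≤ (1 - ‖z‖) * (4 * (1 - ‖ζ‖)) := by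
        nlinarith
      exact le_of_mul_le_mul_left h7 (by linarith)
    linarith

/-- The local area mean of `|f|^p` dominates `|f|^p` on the pseudohyperbolic disc. -/
theorem enorm_rpow_le_of_mem_pseudoDisc {f : ℂ → ℂ} {p r κ : ℝ} (hp : 0 < p)
    (hr₀ : 0 < r) (hr₁ : r < 1) (hκ₀ : 0 < κ) (hκ : κ ≤ (1 - r ^ 2) / 16)
    (hf : DifferentiableOn ℂ f unitDisc) {z ζ : ℂ} (hz : z ∈ unitDisc)
    (hζ : ζ ∈ pseudoDisc z r) :
    ENNReal.ofReal (π * (κ * (1 - ‖z‖)) ^ 2) * ‖f ζ‖ₑ ^ p ≤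
      ∫⁻ w in ball z ((2 * r / (1 - r) + κ) * (1 - ‖z‖)) ∩ ball 0 (1 - κ * (1 - ‖z‖)),
        ‖f w‖ₑ ^ p := by
  obtain ⟨h1, h2⟩ := pseudoDisc_estimates hr₀ hr₁ hz hζ
  have hz1 := norm_lt_one_of_mem hz
  have hη : 0 < κ * (1 - ‖z‖) := mul_pos hκ₀ (by linarith)
  have h3 : κ * (1 - ‖z‖) ≤ (1 - r ^ 2) / 16 * (1 - ‖z‖) :=
    mul_le_mul_of_nonneg_right hκ (by linarith)
  -- This needs `|ζ| + 2 κ (1 - |z|) ≤ 1`, which is why `κ` is at most half of the constant `(1 - r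
  -- ^ 2) / 8`.
  have hsub0 : ball ζ (κ * (1 - ‖z‖)) ⊆ ball 0 (1 - κ * (1 - ‖z‖)) := by
    refine ball_subset_ball' ?_
    rw [dist_zero_right]; linarith
  have hsub1 : ball ζ (κ * (1 - ‖z‖)) ⊆ unitDisc := by
    refine hsub0.trans (ball_subset_ball ?_)
    linarith
  refine (enorm_rpow_le_lintegral_ball hη hp (hf.mono hsub1)).trans
    (lintegral_mono_set (subset_inter ?_ hsub0))
  refine ball_subset_ball' ?_
  rw [dist_eq_norm]; linarith

/-- Integrals of `|f|^p` over centred circles, in terms of the circle average. -/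
theorem lintegral_enorm_rpow_circleMap {f : ℂ → ℂ} {p s : ℝ} (hp : 0 < p)
    (hf : DifferentiableOn ℂ f unitDisc) (hs : s ∈ Ico (0 : ℝ) 1) (α : ℝ) :
    ∫⁻ θ in Ioo (-π) π, ‖f (circleMap 0 s (θ + α))‖ₑ ^ p
      = ENNReal.ofReal (2 * π * circleAverage (fun z => ‖f z‖ ^ p) 0 s) := by
  have hsub : sphere (0 : ℂ) |s| ⊆ unitDisc := by
    rw [abs_of_nonneg hs.1]
    exact sphere_subset_closedBall.trans (closedBall_subset_ball hs.2)
  rw [← lintegral_circleMap_eq ((hf.continuousOn.mono hsub).norm.rpow_const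
    fun _ _ => Or.inr hp.le) (fun _ _ => by positivity) α]
  exact lintegral_congr fun θ => enorm_rpow_eq hp _

/-- The circular integral of local area integrals of `|f|^p`. -/
theorem lintegral_lintegral_ball_le {f : ℂ → ℂ} {p s ρ κ : ℝ} (hp : 0 < p)
    (hf : DifferentiableOn ℂ f unitDisc) (hρ : ρ ∈ Ico (0 : ℝ) 1) :
    ∫⁻ φ in Ioo (-π) π, ∫⁻ w in ball (circleMap 0 s φ) κ ∩ ball 0 ρ, ‖f w‖ₑ ^ p ≤
      ENNReal.ofReal (2 * π * circleAverage (fun z => ‖f z‖ ^ p) 0 ρ) *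
        volume (ball (s : ℂ) κ) := by
  set g : ℂ → ℝ≥0∞ := unitDisc.indicator fun z => ‖f z‖ₑ ^ p with hg
  have hgm : Measurable g :=
    measurable_indicator_enorm_rpow isOpen_ball hf
  set A : Set ℂ := ball (s : ℂ) κ ∩ ball 0 ρ with hA
  have hAm : MeasurableSet A := measurableSet_ball.inter measurableSet_ball
  have hball : ball (0 : ℂ) ρ ⊆ unitDisc := ball_subset_ball hρ.2.le
  -- Rotating by `-φ` fixes the domain of integration. After the exchange of integrals, the inner
  -- one runs over a full circle of radius `‖w‖ < ρ`, and monotonicity applies.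
  have hrot : ∀ φ : ℝ, ∫⁻ w in ball (circleMap 0 s φ) κ ∩ ball 0 ρ, ‖f w‖ₑ ^ p
      = ∫⁻ w in A, g (circleMap 0 1 φ * w) := by
    intro φ
    let e := rotation (Circle.exp φ)
    have he : ∀ w, e w = circleMap 0 1 φ * w := fun w => by
      simp [e, rotation_apply, Circle.coe_exp, circleMap]
    have hpre : e ⁻¹' (ball (circleMap 0 s φ) κ ∩ ball 0 ρ) = A := by
      have hes : circleMap 0 s φ = e s := by
        rw [he]; simp [circleMap, mul_comm]
      ext w
      rw [hes, hA, mem_preimage, mem_inter_iff, mem_inter_iff, mem_ball, mem_ball, mem_ball,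
        mem_ball, e.dist_map, dist_zero_right, dist_zero_right, e.norm_map]
    have h1 := e.measurePreserving.setLIntegral_comp_preimage_emb
      e.toHomeomorph.measurableEmbedding g (ball (circleMap 0 s φ) κ ∩ ball 0 ρ)
    rw [hpre] at h1
    simp_rw [he] at h1
    rw [h1]
    refine setLIntegral_congr_fun (measurableSet_ball.inter measurableSet_ball) fun w hw => ?_
    rw [hg, indicator_of_mem (hball hw.2)]
  simp_rw [hrot]
  rw [lintegral_lintegral_swap]
  · calc ∫⁻ w in A, ∫⁻ φ in Ioo (-π) π, g (circleMap 0 1 φ * w)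
        ≤ ∫⁻ w in A, ENNReal.ofReal (2 * π * circleAverage (fun z => ‖f z‖ ^ p) 0 ρ) := by
          refine setLIntegral_mono' hAm fun w hw => ?_
          have hwρ : ‖w‖ < ρ := mem_ball_zero_iff.1 hw.2
          have hw1 : ‖w‖ ∈ Ico (0 : ℝ) 1 := ⟨norm_nonneg _, hwρ.trans hρ.2⟩
          have : ∀ φ, g (circleMap 0 1 φ * w) = ‖f (circleMap 0 ‖w‖ (φ + w.arg))‖ₑ ^ p := by
            intro φ
            have h2 : circleMap 0 1 φ * w = circleMap 0 ‖w‖ (φ + w.arg) := by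
              conv_lhs => rw [← Complex.norm_mul_exp_arg_mul_I w]
              simp only [circleMap, zero_add, Complex.ofReal_add, Complex.ofReal_one, one_mul,
                add_mul, Complex.exp_add]
              ring
            rw [h2, hg, indicator_of_mem]
            rw [unitDisc, mem_ball_zero_iff, norm_circleMap_zero, abs_of_nonneg hw1.1]
            exact hw1.2
          simp_rw [this]
          rw [lintegral_enorm_rpow_circleMap hp hf hw1]
          gcongr
          exact circleAverage_norm_rpow_mono hp hf hw1 hρ hwρ.le
      _ = ENNReal.ofReal (2 * π * circleAverage (fun z => ‖f z‖ ^ p) 0 ρ) * volume A := by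
          rw [setLIntegral_const]
      _ ≤ _ := by gcongr; exact inter_subset_left
  · refine (hgm.comp ?_).aemeasurable
    have : Continuous fun q : ℝ × ℂ => circleMap 0 1 q.1 * q.2 := by fun_prop
    exact this.measurable

-- Moving towards the boundary with doubling tails.

/-- Monotone functions may be evaluated closer to the boundary when integrated against a density
with doubling tails. -/
theorem lintegral_comp_halfway_le {w : ℝ → ℝ≥0∞} (hw : Measurable w) {C : ℝ≥0∞}
    (hC : ∀ t : ℝ, 0 ≤ t → t < 1 → ∫⁻ s in Ioo t 1, w s ≤ C * ∫⁻ s in Ioo ((1 + t) / 2) 1, w s)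
    {V : ℝ → ℝ} (hV : MonotoneOn V (Ico 0 1)) (hV0 : ∀ s ∈ Ico (0 : ℝ) 1, 0 ≤ V s) :
    ∫⁻ s in Ioo (0 : ℝ) 1, ENNReal.ofReal s * w s * ENNReal.ofReal (V ((1 + s) / 2)) ≤
      2 * C * ∫⁻ s in Ioo (0 : ℝ) 1, ENNReal.ofReal s * w s * ENNReal.ofReal (V s) := by
  set μ : Measure ℝ := (volume.restrict (Ioo (0 : ℝ) 1)).withDensity
    fun s => ENNReal.ofReal s * w s with hμ
  have hdm : Measurable fun s : ℝ => ENNReal.ofReal s * w s := by fun_prop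
  have hac : μ ≪ volume.restrict (Ioo (0 : ℝ) 1) := withDensity_absolutelyContinuous _ _
  have hmem : ∀ᵐ s ∂μ, s ∈ Ioo (0 : ℝ) 1 := hac.ae_le (ae_restrict_mem measurableSet_Ioo)
  have hVσ : MonotoneOn (fun s => V ((1 + s) / 2)) (Ioo 0 1) := fun a ha b hb hab =>
    hV ⟨by linarith [ha.1], by linarith [ha.2]⟩ ⟨by linarith [hb.1], by linarith [hb.2]⟩
      (by linarith)
  have hm1 : AEMeasurable (fun s => V ((1 + s) / 2)) (volume.restrict (Ioo (0 : ℝ) 1)) :=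
    aemeasurable_restrict_of_monotoneOn measurableSet_Ioo hVσ
  have hm2 : AEMeasurable V (volume.restrict (Ioo (0 : ℝ) 1)) :=
    aemeasurable_restrict_of_monotoneOn measurableSet_Ioo (hV.mono Ioo_subset_Ico_self)
  have e1 : ∫⁻ s in Ioo (0 : ℝ) 1, ENNReal.ofReal s * w s * ENNReal.ofReal (V ((1 + s) / 2))
      = ∫⁻ s, ENNReal.ofReal (V ((1 + s) / 2)) ∂μ := by
    rw [hμ, lintegral_withDensity_eq_lintegral_mul₀ hdm.aemeasurable hm1.ennreal_ofReal]
    rfl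
  have e2 : ∫⁻ s in Ioo (0 : ℝ) 1, ENNReal.ofReal s * w s * ENNReal.ofReal (V s)
      = ∫⁻ s, ENNReal.ofReal (V s) ∂μ := by
    rw [hμ, lintegral_withDensity_eq_lintegral_mul₀ hdm.aemeasurable hm2.ennreal_ofReal]
    rfl
  -- Layer cake: it suffices to compare the `μ`-measures of the superlevel sets at each level `l`.
  rw [e1, e2, lintegral_eq_lintegral_meas_lt μ ?_ (hm1.mono_ac hac),
    lintegral_eq_lintegral_meas_lt μ ?_ (hm2.mono_ac hac), ← lintegral_const_mul]
  rotate_left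
  · exact Antitone.measurable fun a b hab => measure_mono fun s (hs : b < V s) => hab.trans_lt hs
  · filter_upwards [hmem] with s hs using hV0 s ⟨hs.1.le, hs.2⟩
  · filter_upwards [hmem] with s hs using hV0 _ ⟨by linarith [hs.1], by linarith [hs.2]⟩
  refine lintegral_mono fun l => ?_
  set A : Set ℝ := {s | s ∈ Ioo (0 : ℝ) 1 ∧ l < V ((1 + s) / 2)} with hA
  have hA1 : μ {s | l < V ((1 + s) / 2)} = μ A :=
    measure_congr (by
      filter_upwards [hmem] with s hs
      exact propext ⟨fun h => ⟨hs, h⟩, fun h => h.2⟩)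
  rw [hA1]
  rcases A.eq_empty_or_nonempty with h | hne
  · simp [h]
  have hbdd : BddBelow A := ⟨0, fun s hs => hs.1.1.le⟩
  set t := sInf A with ht
  have ht0 : 0 ≤ t := le_csInf hne fun s hs => hs.1.1.le
  have ht1 : t < 1 := by
    obtain ⟨a, ha⟩ := hne
    exact (csInf_le hbdd ha).trans_lt ha.1.2
  have hB : Ioo ((1 + t) / 2) 1 ⊆ {s | l < V s} := by
    intro s hs
    obtain ⟨a, ha, has⟩ := exists_lt_of_csInf_lt hne (show t < 2 * s - 1 by linarith [hs.1])
    exact ha.2.trans_le (hV ⟨by linarith [ha.1.1], by linarith [ha.1.2]⟩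
      ⟨by linarith [hs.1], hs.2⟩ (by linarith))
  have happ : ∀ a : ℝ, 0 ≤ a → μ (Ioo a 1) = ∫⁻ s in Ioo a 1, ENNReal.ofReal s * w s := by
    intro a ha
    rw [hμ, withDensity_apply _ measurableSet_Ioo, Measure.restrict_restrict measurableSet_Ioo,
      inter_eq_left.2 (Ioo_subset_Ioo_left ha)]
  calc μ A ≤ μ (Ioo t 1) := by
        refine measure_mono_ae ?_
        have hnt : ∀ᵐ s ∂μ, s ≠ t :=
          hac.ae_le (ae_restrict_of_ae (Measure.ae_ne volume t))
        filter_upwards [hnt] with s hs hsA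
        exact ⟨lt_of_le_of_ne (csInf_le hbdd hsA) hs.symm, hsA.1.2⟩
    _ ≤ ∫⁻ s in Ioo t 1, w s := by
        rw [happ t ht0]
        refine setLIntegral_mono' measurableSet_Ioo fun s hs => ?_
        refine (mul_le_mul_left (ENNReal.ofReal_le_one.2 hs.2.le) _).trans_eq (one_mul _)
    _ ≤ C * ∫⁻ s in Ioo ((1 + t) / 2) 1, w s := hC t ht0 ht1
    -- The density of `μ` carries the polar factor `s`: bounded by 1 in the previous estimate, and
    -- at least `1/2` here since `s > (1 + t) / 2`.
    _ ≤ C * (2 * μ (Ioo ((1 + t) / 2) 1)) := by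
        gcongr
        rw [happ _ (by linarith), ← lintegral_const_mul _ hdm]
        refine setLIntegral_mono' measurableSet_Ioo fun s hs => ?_
        rw [← mul_assoc]
        refine (one_mul (w s)).symm.trans_le (mul_le_mul_left ?_ _)
        rw [← ENNReal.ofReal_ofNat, ← ENNReal.ofReal_mul (by norm_num), ENNReal.one_le_ofReal]
        linarith [hs.1]
    _ = 2 * C * μ (Ioo ((1 + t) / 2) 1) := by ring
    _ ≤ _ := by gcongr

/-- `s ↦ 1 - 2^{-n} (1 - s)` is the `n`-th iterate of `s ↦ (1 + s) / 2`, and composing with an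
iterate keeps `V` increasing, so the halfway estimate can be repeated. -/
theorem lintegral_comp_near_boundary_le {w : ℝ → ℝ≥0∞} (hw : Measurable w) {C : ℝ≥0∞}
    (hC : ∀ t : ℝ, 0 ≤ t → t < 1 → ∫⁻ s in Ioo t 1, w s ≤ C * ∫⁻ s in Ioo ((1 + t) / 2) 1, w s)
    {V : ℝ → ℝ} (hV : MonotoneOn V (Ico 0 1)) (hV0 : ∀ s ∈ Ico (0 : ℝ) 1, 0 ≤ V s) (n : ℕ) :
    ∫⁻ s in Ioo (0 : ℝ) 1, ENNReal.ofReal s * w s *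
        ENNReal.ofReal (V (1 - (1 / 2) ^ n * (1 - s))) ≤
      (2 * C) ^ n * ∫⁻ s in Ioo (0 : ℝ) 1, ENNReal.ofReal s * w s * ENNReal.ofReal (V s) := by
  have hmaps : ∀ n : ℕ, ∀ s ∈ Ico (0 : ℝ) 1, 1 - (1 / 2) ^ n * (1 - s) ∈ Ico (0 : ℝ) 1 := by
    intro n s hs
    have h1 : (0 : ℝ) < (1 / 2) ^ n := by positivity
    have h2 : (1 / 2 : ℝ) ^ n ≤ 1 := pow_le_one₀ (by norm_num) (by norm_num)
    exact ⟨by nlinarith [hs.1, hs.2], by nlinarith [hs.1, hs.2]⟩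
  induction n with
  | zero => simp
  | succ n ih =>
    have h1 : (0 : ℝ) < (1 / 2) ^ n := by positivity
    have hstep := lintegral_comp_halfway_le hw hC (V := fun s => V (1 - (1 / 2) ^ n * (1 - s)))
      (fun a ha b hb hab => hV (hmaps n a ha) (hmaps n b hb) (by nlinarith))
      (fun s hs => hV0 _ (hmaps n s hs))
    have e : ∀ s : ℝ, 1 - (1 / 2 : ℝ) ^ (n + 1) * (1 - s)
        = 1 - (1 / 2) ^ n * (1 - (1 + s) / 2) := fun s => by ring
    simp_rw [e]
    refine hstep.trans ?_
    rw [pow_succ', mul_assoc (2 * C)]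
    exact mul_le_mul_right ih _

-- Null sets in polar coordinates and radial densities.

/-- The Jacobian `s` is positive for `0 < s`, so planar null sets pull back to null sets of polar
coordinates. -/
theorem ae_circleMap_of_ae {P : ℂ → Prop} (h : ∀ᵐ z, P z) :
    ∀ᵐ q ∂(volume.restrict (Ioo (0 : ℝ) 1)).prod (volume.restrict (Ioo (-π) π)),
      P (circleMap 0 q.1 q.2) := by
  obtain ⟨N, hN, hNm, hN0⟩ := exists_measurable_superset_of_null (ae_iff.1 h)
  have h1 := setLIntegral_polar 0 (N.indicator 1)
  rw [lintegral_indicator_one hNm, hN0] at h1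
  have hm : Measurable fun q : ℝ × ℝ =>
      ENNReal.ofReal q.1 * (N.indicator 1 (circleMap 0 q.1 q.2) : ℝ≥0∞) := by
    have h2 : Measurable fun q : ℝ × ℝ => circleMap 0 q.1 q.2 := circleMap.continuous.measurable
    have h3 : Measurable (N.indicator (1 : ℂ → ℝ≥0∞)) := measurable_one.indicator hNm
    fun_prop
  rw [lintegral_eq_zero_iff hm] at h1
  rw [Measure.prod_restrict, ← Measure.volume_eq_prod]
  have h2 := ae_restrict_of_ae_restrict_of_subset
    (prod_mono (show Ioo (0 : ℝ) 1 ⊆ Ioi 0 from fun s hs => hs.1) (subset_refl (Ioo (-π) π))) h1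
  filter_upwards [h2, ae_restrict_mem (measurableSet_Ioo.prod measurableSet_Ioo)] with q hq hq'
  by_contra hP
  have : circleMap 0 q.1 q.2 ∈ N := hN hP
  simp [this] at hq
  linarith [hq'.1.1]

theorem ae_norm_of_ae {Q : ℝ → Prop} (h : ∀ᵐ s ∂volume.restrict (Ioo (0 : ℝ) 1), Q s) :
    ∀ᵐ z ∂(volume : Measure ℂ).restrict unitDisc, Q ‖z‖ := by
  have h' := (ae_restrict_iff' measurableSet_Ioo).1 h
  obtain ⟨N, hN, hNm, hN0⟩ := exists_measurable_superset_of_null (ae_iff.1 h')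
  have hpre : MeasurableSet ((fun z : ℂ => ‖z‖) ⁻¹' N) := measurable_norm hNm
  have h0 : volume ((fun z : ℂ => ‖z‖) ⁻¹' N) = 0 := by
    rw [← nonpos_iff_eq_zero, ← lintegral_indicator_one hpre]
    refine (lintegral_le_polar 0 _).trans_eq ?_
    have hae : ∀ᵐ s : ℝ, s ∉ N := measure_eq_zero_iff_ae_notMem.1 hN0
    refine (lintegral_congr_ae (g := 0) ?_).trans (by simp)
    filter_upwards [ae_restrict_of_ae hae, ae_restrict_mem measurableSet_Ioi] with s hs hs'
    have : ∀ θ, circleMap 0 s θ ∉ (fun z : ℂ => ‖z‖) ⁻¹' N := fun θ => by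
      simpa [abs_of_pos (show 0 < s from hs')] using hs
    simp [this]
  have hae : ∀ᵐ z : ℂ, ‖z‖ ∉ N := measure_eq_zero_iff_ae_notMem.1 h0
  rw [ae_restrict_iff' measurableSet_unitDisc]
  filter_upwards [hae, Measure.ae_ne volume (0 : ℂ)] with z hz hz0 hzD
  by_contra hQ
  refine hz (hN ?_)
  intro hc
  exact hQ (hc ⟨norm_pos_iff.2 hz0, mem_ball_zero_iff.1 hzD⟩)

/-- A radial weight agrees almost everywhere with a measurable density on radii. -/
theorem exists_measurable_radial {ω : ℂ → ℝ} (hω : IsWeight ω) (hrad : IsRadial ω) :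
    ∃ w : ℝ → ℝ≥0∞, Measurable w ∧ (∀ s, w s ≠ ∞) ∧
      ∀ᵐ s : ℝ ∂volume.restrict (Ioo (0 : ℝ) 1), ENNReal.ofReal (ω (s : ℂ)) = w s := by
  have hbound : AEMeasurable ω ((volume : Measure ℂ).restrict unitDisc) := by
    have h := hω.integrable.aestronglyMeasurable.aemeasurable
    have hc : ENNReal.ofReal π⁻¹ ≠ 0 := by simp [pi_pos]
    rw [discArea] at h
    exact h.mono_ac (Measure.absolutelyContinuous_smul hc)
  obtain ⟨g, hgm, hg⟩ := hbound
  have hg' : ∀ᵐ z, z ∈ unitDisc → ω z = g z :=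
    (ae_restrict_iff' measurableSet_unitDisc).1 hg
  have h1 := ae_circleMap_of_ae hg'
  have h2 := Measure.ae_ae_of_ae_prod
    (Measure.measurePreserving_swap.quasiMeasurePreserving.ae h1)
  have hne : (ae (volume.restrict (Ioo (-π) π))).NeBot := by
    rw [ae_neBot, Ne, Measure.restrict_eq_zero]
    simp [pi_pos]
  -- The positive real axis is itself null in the plane, so `g` may be wrong there. Fubini supplies
  -- some ray on which `ω = g` at almost every radius, and radiality carries the values back to the
  -- axis.
  obtain ⟨θ, hθ⟩ := h2.exists
  refine ⟨fun s => ENNReal.ofReal (g (circleMap 0 s θ)), ?_, fun _ => ENNReal.ofReal_ne_top, ?_⟩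
  · have : Measurable fun s : ℝ => circleMap 0 s θ := by
      unfold circleMap; fun_prop
    fun_prop
  · filter_upwards [hθ, ae_restrict_mem measurableSet_Ioo] with s hs hs'
    have hn : ‖circleMap 0 s θ‖ = s := by rw [norm_circleMap_zero, abs_of_pos hs'.1]
    have hmem : circleMap 0 s θ ∈ unitDisc := by
      rw [unitDisc, mem_ball_zero_iff, hn]; exact hs'.2
    have h3 := hrad _ hmem
    rw [hn] at h3
    rw [← h3]
    congr 1
    exact hs hmem

-- Weighted bound for the local means.

/-- The normalized integral of `|f|^p` over a neighbourhood of `z` containing the discs of radius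
`κ (1 - |z|)` around the points of the pseudohyperbolic disc `Δ(z, r)`. -/
noncomputable def localMean (p r κ : ℝ) (f : ℂ → ℂ) (z : ℂ) : ℝ≥0∞ :=
  (ENNReal.ofReal (π * (κ * (1 - ‖z‖)) ^ 2))⁻¹ *
    ∫⁻ w in ball z ((2 * r / (1 - r) + κ) * (1 - ‖z‖)) ∩ ball 0 (1 - κ * (1 - ‖z‖)), ‖f w‖ₑ ^ p

theorem average_le_localMean {f : ℂ → ℂ} {p r κ : ℝ} (hp : 0 < p)
    (hr₀ : 0 < r) (hr₁ : r < 1) (hκ₀ : 0 < κ) (hκ : κ ≤ (1 - r ^ 2) / 16)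
    (hf : DifferentiableOn ℂ f unitDisc) {ν : Measure ℂ} {S : ℂ → Set ℂ}
    (hS : IsAveragingFamily r ν S) {z : ℂ} (hz : z ∈ unitDisc) :
    average p ν S f z ≤ localMean p r κ f z := by
  have hz1 := norm_lt_one_of_mem hz
  have hpos : 0 < π * (κ * (1 - ‖z‖)) ^ 2 := by
    have : 0 < κ * (1 - ‖z‖) := mul_pos hκ₀ (by linarith)
    positivity
  have hpt : ∀ ζ ∈ S z, ‖f ζ‖ₑ ^ p ≤ localMean p r κ f z := by
    intro ζ hζ
    rw [localMean, ← ENNReal.div_eq_inv_mul, ENNReal.le_div_iff_mul_le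
      (Or.inl (ENNReal.ofReal_pos.2 hpos).ne') (Or.inl ENNReal.ofReal_ne_top), mul_comm]
    exact enorm_rpow_le_of_mem_pseudoDisc hp hr₀ hr₁ hκ₀ hκ hf hz (hS.subset z hz hζ)
  have hbound : ∫⁻ ζ in S z, ‖f ζ‖ₑ ^ p ∂ν ≤ localMean p r κ f z * ν (S z) := by
    rw [← setLIntegral_const]
    refine lintegral_mono_ae ?_
    exact (ae_restrict_mem₀ (hS.measurable z hz)).mono hpt
  calc average p ν S f z ≤ (ν (S z))⁻¹ * (localMean p r κ f z * ν (S z)) := by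
        rw [average]; gcongr
    _ = localMean p r κ f z * ((ν (S z))⁻¹ * ν (S z)) := by ring
    -- Only an inequality: if `ν (S z) = ∞`, the product is `0 * ∞ = 0`.
    _ ≤ localMean p r κ f z * 1 := by gcongr; exact ENNReal.inv_mul_le_one _
    _ = _ := mul_one _

/-- The circular integral of the local means. -/
theorem lintegral_localMean_le {f : ℂ → ℂ} {p r κ s : ℝ} (hp : 0 < p)
    (hr₀ : 0 < r) (hr₁ : r < 1) (hκ₀ : 0 < κ) (hκ₁ : κ ≤ 1)
    (hf : DifferentiableOn ℂ f unitDisc) (hs : s ∈ Ioo (0 : ℝ) 1) :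
    ∫⁻ φ in Ioo (-π) π, localMean p r κ f (circleMap 0 s φ) ≤
      ENNReal.ofReal (((2 * r / (1 - r) + κ) / κ) ^ 2) *
        ENNReal.ofReal (2 * π * circleAverage (fun z => ‖f z‖ ^ p) 0 (1 - κ * (1 - s))) := by
  set K := 2 * r / (1 - r) + κ with hK
  have hK0 : 0 < K := by
    have : 0 < 2 * r / (1 - r) := div_pos (by linarith) (by linarith)
    linarith
  have hs1 : 0 < 1 - s := by linarith [hs.2]
  have hn : ∀ φ, ‖circleMap 0 s φ‖ = s := fun φ => by
    rw [norm_circleMap_zero, abs_of_pos hs.1]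
  have hρ : 1 - κ * (1 - s) ∈ Ico (0 : ℝ) 1 := by
    have := mul_pos hκ₀ hs1
    exact ⟨by nlinarith [hs.1], by linarith⟩
  have hpos : 0 < π * (κ * (1 - s)) ^ 2 := by positivity
  simp only [localMean, hn]
  rw [lintegral_const_mul' _ _ (ENNReal.inv_ne_top.2 (ENNReal.ofReal_pos.2 hpos).ne')]
  calc _ ≤ (ENNReal.ofReal (π * (κ * (1 - s)) ^ 2))⁻¹ *
        (ENNReal.ofReal (2 * π * circleAverage (fun z => ‖f z‖ ^ p) 0 (1 - κ * (1 - s))) *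
          volume (ball (s : ℂ) (K * (1 - s)))) := by
        gcongr
        exact lintegral_lintegral_ball_le hp hf hρ
    _ = ((ENNReal.ofReal (π * (κ * (1 - s)) ^ 2))⁻¹ * ENNReal.ofReal (π * (K * (1 - s)) ^ 2)) *
        ENNReal.ofReal (2 * π * circleAverage (fun z => ‖f z‖ ^ p) 0 (1 - κ * (1 - s))) := by
        have : volume (ball (s : ℂ) (K * (1 - s))) = ENNReal.ofReal (π * (K * (1 - s)) ^ 2) := by
          rw [Complex.volume_ball, ENNReal.ofReal_mul pi_pos.le, ENNReal.ofReal_pow (by positivity),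
            mul_comm]
          congr 1
          rw [← NNReal.coe_real_pi, ENNReal.ofReal_coe_nnreal]
        rw [this]; ring
    _ = _ := by
        -- The factor `(1 - s) ^ 2` cancels: the ratio of the two disc areas is `(K / κ) ^ 2`,
        -- independent of `s`.
        rw [← ENNReal.ofReal_inv_of_pos hpos, ← ENNReal.ofReal_mul (by positivity)]
        congr 2
        field_simp

/-- Norms with radial weights in polar coordinates. -/
theorem lintegral_enorm_rpow_mul_weight {ω : ℂ → ℝ} (hrad : IsRadial ω) {w : ℝ → ℝ≥0∞}
    (hw : Measurable w)
    (hωw : ∀ᵐ s : ℝ ∂volume.restrict (Ioo (0 : ℝ) 1), ENNReal.ofReal (ω (s : ℂ)) = w s)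
    {f : ℂ → ℂ} {p : ℝ} (hp : 0 < p) (hf : DifferentiableOn ℂ f unitDisc) :
    ∫⁻ z in unitDisc, ‖f z‖ₑ ^ p * ENNReal.ofReal (ω z) =
      ∫⁻ s in Ioo (0 : ℝ) 1, ENNReal.ofReal s * w s *
        ENNReal.ofReal (2 * π * circleAverage (fun z => ‖f z‖ ^ p) 0 s) := by
  set g : ℂ → ℝ≥0∞ := unitDisc.indicator fun z => ‖f z‖ₑ ^ p with hg
  have hgm : Measurable g :=
    measurable_indicator_enorm_rpow isOpen_ball hf
  have h1 : ∫⁻ z in unitDisc, ‖f z‖ₑ ^ p * ENNReal.ofReal (ω z) = ∫⁻ z, g z * w ‖z‖ := by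
    rw [← setLIntegral_eq_of_support_subset (f := fun z => g z * w ‖z‖) (s := unitDisc)]
    · refine lintegral_congr_ae ?_
      filter_upwards [ae_norm_of_ae hωw, ae_restrict_mem measurableSet_unitDisc] with z hz hzD
      rw [hg, indicator_of_mem hzD, hrad z hzD, hz]
    · intro z hz
      by_contra hzD
      exact hz (by simp [hg, hzD])
  rw [h1, lintegral_eq_polar 0 (by fun_prop),
    ← setLIntegral_eq_of_support_subset (s := Iio (1 : ℝ)),
    Measure.restrict_restrict measurableSet_Iio, inter_comm, Ioi_inter_Iio]
  · refine setLIntegral_congr_fun measurableSet_Ioo fun s hs => ?_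
    have hn : ∀ φ, ‖circleMap 0 s φ‖ = s := fun φ => by
      rw [norm_circleMap_zero, abs_of_pos hs.1]
    have hmem : ∀ φ, circleMap 0 s φ ∈ unitDisc := fun φ => by
      rw [unitDisc, mem_ball_zero_iff, hn]; exact hs.2
    have h2 := lintegral_enorm_rpow_circleMap hp hf ⟨hs.1.le, hs.2⟩ 0
    simp only [add_zero] at h2
    simp only [hn, hg, indicator_of_mem (hmem _)]
    rw [lintegral_mul_const, h2]
    · ring
    · have : Measurable fun φ => g (circleMap 0 s φ) :=
        hgm.comp (continuous_circleMap 0 s).measurable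
      simpa only [hg, indicator_of_mem (hmem _)] using this
  · intro s hs
    by_contra hs1
    refine hs ?_
    have hmem : ∀ φ, circleMap 0 s φ ∉ unitDisc := fun φ => by
      rw [unitDisc, mem_ball_zero_iff, norm_circleMap_zero, not_lt]
      exact (not_lt.1 hs1).trans (le_abs_self s)
    simp [hg, indicator_of_notMem (hmem _)]

/-- The local means are bounded in the weighted space, uniformly in `p` and `f`. -/
theorem exists_lintegral_localMean_le {ω : ℂ → ℝ} (hω : MemDHat ω) {r : ℝ}
    (hr₀ : 0 < r) (hr₁ : r < 1) :
    ∃ κ C : ℝ, 0 < κ ∧ κ ≤ (1 - r ^ 2) / 16 ∧ 0 < C ∧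
      ∀ (p : ℝ), 0 < p → ∀ f : ℂ → ℂ, DifferentiableOn ℂ f unitDisc →
        ∫⁻ z in unitDisc, localMean p r κ f z * ENNReal.ofReal (ω z) ≤
          ENNReal.ofReal C * ∫⁻ z in unitDisc, ‖f z‖ₑ ^ p * ENNReal.ofReal (ω z) := by
  obtain ⟨D, hD1, hD⟩ := hω.doubling
  obtain ⟨w, hwm, hwfin, hw⟩ := exists_measurable_radial hω.isWeight hω.isRadial
  have hr2 : 0 < (1 - r ^ 2) / 16 := by nlinarith
  -- A power of `1/2` makes the passage to radius `1 - κ (1 - s)` a whole number of halvings. Here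
  -- `n` depends only on `r`, and `D` only on `ω`.
  obtain ⟨n, hn⟩ := exists_pow_lt_of_lt_one hr2 (show (1 / 2 : ℝ) < 1 by norm_num)
  set κ : ℝ := (1 / 2) ^ n with hκ
  have hκ0 : 0 < κ := by positivity
  have hκ1 : κ ≤ 1 := pow_le_one₀ (by norm_num) (by norm_num)
  set K := (2 * r / (1 - r) + κ) / κ with hK
  have hK0 : 0 < K := by
    have : 0 < 2 * r / (1 - r) := div_pos (by linarith) (by linarith)
    positivity
  refine ⟨κ, K ^ 2 * (2 * D) ^ n, hκ0, hn.le, by positivity, fun p hp f hf => ?_⟩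
  have htail : ∀ t : ℝ, 0 ≤ t → tail ω t = ∫⁻ s in Ioo t 1, w s := fun t ht =>
    lintegral_congr_ae (ae_restrict_of_ae_restrict_of_subset (Ioo_subset_Ioo_left ht) hw)
  have hC : ∀ t : ℝ, 0 ≤ t → t < 1 → ∫⁻ s in Ioo t 1, w s ≤
      ENNReal.ofReal D * ∫⁻ s in Ioo ((1 + t) / 2) 1, w s := fun t ht ht1 => by
    rw [← htail t ht, ← htail _ (by linarith)]
    exact hD t ht ht1
  set V : ℝ → ℝ := fun s => 2 * π * circleAverage (fun z => ‖f z‖ ^ p) 0 s with hV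
  have hVm : MonotoneOn V (Ico 0 1) := fun a ha b hb hab =>
    mul_le_mul_of_nonneg_left (circleAverage_norm_rpow_mono hp hf ha hb hab) two_pi_pos.le
  have hV0 : ∀ s ∈ Ico (0 : ℝ) 1, 0 ≤ V s := fun s _ =>
    mul_nonneg two_pi_pos.le (circleAverage_nonneg_of_nonneg fun _ _ => by positivity)
  have hmain := lintegral_comp_near_boundary_le hwm hC hVm hV0 n
  rw [lintegral_enorm_rpow_mul_weight hω.isRadial hwm hw hp hf]
  calc ∫⁻ z in unitDisc, localMean p r κ f z * ENNReal.ofReal (ω z)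
      = ∫⁻ z in unitDisc, localMean p r κ f z * w ‖z‖ := by
        refine lintegral_congr_ae ?_
        filter_upwards [ae_norm_of_ae hw, ae_restrict_mem measurableSet_unitDisc] with z hz hzD
        rw [hω.isRadial z hzD, hz]
    _ = ∫⁻ z, unitDisc.indicator (fun z => localMean p r κ f z * w ‖z‖) z :=
        (lintegral_indicator measurableSet_unitDisc _).symm
    _ ≤ ∫⁻ s in Ioi (0 : ℝ), ENNReal.ofReal s * ∫⁻ θ in Ioo (-π) π,
          unitDisc.indicator (fun z => localMean p r κ f z * w ‖z‖) (circleMap 0 s θ) :=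
        lintegral_le_polar 0 _
    _ ≤ ∫⁻ s in Ioi (0 : ℝ), (Ioo (0 : ℝ) 1).indicator (fun s => ENNReal.ofReal (K ^ 2) *
          (ENNReal.ofReal s * w s * ENNReal.ofReal (V (1 - κ * (1 - s))))) s := by
        refine setLIntegral_mono' measurableSet_Ioi fun s hs => ?_
        have hn : ∀ φ, ‖circleMap 0 s φ‖ = s := fun φ => by
          rw [norm_circleMap_zero, abs_of_pos hs]
        rcases lt_or_ge s 1 with hs1 | hs1
        · have hmem : ∀ φ, circleMap 0 s φ ∈ unitDisc := fun φ => by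
            rw [unitDisc, mem_ball_zero_iff, hn]; exact hs1
          have hsI : s ∈ Ioo (0 : ℝ) 1 := ⟨hs, hs1⟩
          rw [indicator_of_mem hsI]
          simp only [hn, indicator_of_mem (hmem _)]
          rw [lintegral_mul_const' _ _ (hwfin s)]
          calc _ ≤ ENNReal.ofReal s * (ENNReal.ofReal (K ^ 2) *
                ENNReal.ofReal (V (1 - κ * (1 - s))) * w s) := by
                gcongr
                exact lintegral_localMean_le hp hr₀ hr₁ hκ0 hκ1 hf hsI
            _ = _ := by ring
        · have hmem : ∀ φ, circleMap 0 s φ ∉ unitDisc := fun φ => by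
            rw [unitDisc, mem_ball_zero_iff, hn, not_lt]; exact hs1
          simp [indicator_of_notMem (hmem _)]
    _ = ENNReal.ofReal (K ^ 2) * ∫⁻ s in Ioo (0 : ℝ) 1,
          ENNReal.ofReal s * w s * ENNReal.ofReal (V (1 - κ * (1 - s))) := by
        rw [lintegral_indicator measurableSet_Ioo, Measure.restrict_restrict measurableSet_Ioo,
          inter_eq_left.2 Ioo_subset_Ioi_self, lintegral_const_mul' _ _ ENNReal.ofReal_ne_top]
    _ ≤ ENNReal.ofReal (K ^ 2) * ((2 * ENNReal.ofReal D) ^ n *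
          ∫⁻ s in Ioo (0 : ℝ) 1, ENNReal.ofReal s * w s * ENNReal.ofReal (V s)) := by
        gcongr
    _ = _ := by
        rw [← mul_assoc, ENNReal.ofReal_mul (by positivity),
          ENNReal.ofReal_pow (p := 2 * D) (by positivity),
          ENNReal.ofReal_mul (by norm_num), ENNReal.ofReal_ofNat]

-- The bad set and its complement.

/-- The integral over the bad set is at most a multiple of `ε ‖f‖^p`. -/
theorem exists_integralOver_badSet_le {ω : ℂ → ℝ} (hω : MemDHat ω) {r : ℝ}
    (hr₀ : 0 < r) (hr₁ : r < 1) :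
    ∃ C : ℝ, 0 < C ∧
      ∀ (p : ℝ), 0 < p →
      ∀ (ν : Measure ℂ) (S : ℂ → Set ℂ), IsAveragingFamily r ν S →
      ∀ (f : ℂ → ℂ), MemBergman p ω f →
      ∀ (ε : ℝ), 0 < ε →
        NullMeasurableSet (badSet p ν S ε f) volume →
        integralOver p ω f (badSet p ν S ε f) ≤ ENNReal.ofReal (C * ε) * normPow p ω f := by
  obtain ⟨κ, C, hκ0, hκ, hC0, hC⟩ := exists_lintegral_localMean_le hω hr₀ hr₁
  refine ⟨C, hC0, fun p hp ν S hS f hf ε hε hE => ?_⟩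
  have hsub : badSet p ν S ε f ⊆ unitDisc := fun z hz => hz.1
  have hrestr : ∀ G ⊆ unitDisc, NullMeasurableSet G volume → integralOver p ω f G =
      ENNReal.ofReal π⁻¹ * ∫⁻ z in G, ‖f z‖ₑ ^ p * ENNReal.ofReal (ω z) := by
    intro G hG hGm
    rw [integralOver, discArea, Measure.restrict_smul, lintegral_smul_measure, smul_eq_mul,
      Measure.restrict_restrict₀ (hGm.mono_ac Measure.absolutelyContinuous_restrict),
      inter_eq_left.2 hG]
  rw [normPow, hrestr _ hsub hE, hrestr _ subset_rfl measurableSet_unitDisc.nullMeasurableSet,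
    ENNReal.ofReal_mul hC0.le]
  have hbad : ∫⁻ z in badSet p ν S ε f, ‖f z‖ₑ ^ p * ENNReal.ofReal (ω z) ≤
      ENNReal.ofReal ε * ∫⁻ z in unitDisc, localMean p r κ f z * ENNReal.ofReal (ω z) := by
    rw [← lintegral_const_mul' _ _ ENNReal.ofReal_ne_top]
    refine le_trans (lintegral_mono_ae ?_) (lintegral_mono_set hsub)
    filter_upwards [ae_restrict_mem₀ hE] with z hz
    rw [← mul_assoc]
    gcongr
    refine hz.2.trans ?_
    gcongr
    exact average_le_localMean hp hr₀ hr₁ hκ0 hκ hf.analytic hS hz.1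
  calc _ ≤ ENNReal.ofReal π⁻¹ * (ENNReal.ofReal ε * (ENNReal.ofReal C *
        ∫⁻ z in unitDisc, ‖f z‖ₑ ^ p * ENNReal.ofReal (ω z))) := by
        gcongr
        exact hbad.trans (by gcongr; exact hC p hp f hf.analytic)
    _ = _ := by ring

/-- A set on which at most half of the norm is concentrated has dominating complement. -/
theorem isDominatingFor_diff {ω : ℂ → ℝ} {p : ℝ} {f : ℂ → ℂ} (hf : MemBergman p ω f)
    {B : Set ℂ} (hB : NullMeasurableSet B volume)
    (h : integralOver p ω f B ≤ ENNReal.ofReal (1 / 2) * normPow p ω f) :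
    IsDominatingFor p ω f (unitDisc \ B) := by
  refine ⟨sdiff_subset, measurableSet_unitDisc.nullMeasurableSet.diff hB, 1 / 2, by norm_num, ?_⟩
  have hle : normPow p ω f ≤ integralOver p ω f B + integralOver p ω f (unitDisc \ B) := by
    refine (lintegral_mono_set (fun z hz => ?_)).trans (lintegral_union_le _ B (unitDisc \ B))
    by_cases hzB : z ∈ B
    · exact Or.inl hzB
    · exact Or.inr ⟨hz, hzB⟩
  have hhalf : normPow p ω f = ENNReal.ofReal (1 / 2) * normPow p ω f
      + ENNReal.ofReal (1 / 2) * normPow p ω f := by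
    rw [← add_mul, ← ENNReal.ofReal_add (by norm_num) (by norm_num)]
    norm_num
  have hfin : ENNReal.ofReal (1 / 2) * normPow p ω f ≠ ∞ :=
    ENNReal.mul_ne_top ENNReal.ofReal_ne_top hf.norm_finite.ne
  -- Cancelling half of the norm in `[0, ∞]` is legitimate because `f ∈ A^p_ω` makes it finite.
  refine (ENNReal.add_le_add_iff_left hfin).1 ?_
  rw [← hhalf]
  exact hle.trans (by gcongr)

end WeightedBergman

theorem mainTheorem7 (ω : ℂ → ℝ) (hω : WeightedBergman.MemDHat ω)
    (r : ℝ) (hr₀ : 0 < r) (hr₁ : r < 1) :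
    (∃ C : ℝ, 0 < C ∧
      ∀ (p : ℝ), 0 < p →
      ∀ (ν : Measure ℂ) (S : ℂ → Set ℂ), WeightedBergman.IsAveragingFamily r ν S →
      ∀ (f : ℂ → ℂ), WeightedBergman.MemBergman p ω f →
      ∀ (ε : ℝ), 0 < ε →
        NullMeasurableSet (WeightedBergman.badSet p ν S ε f) volume →
        WeightedBergman.integralOver p ω f (WeightedBergman.badSet p ν S ε f) ≤
          ENNReal.ofReal (C * ε) * WeightedBergman.normPow p ω f) ∧
    (∃ ε₀ : ℝ, 0 < ε₀ ∧
      ∀ (p : ℝ), 0 < p →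
      ∀ (ν : Measure ℂ) (S : ℂ → Set ℂ), WeightedBergman.IsAveragingFamily r ν S →
      ∀ (f : ℂ → ℂ), WeightedBergman.MemBergman p ω f →
      ∀ (ε : ℝ), 0 < ε → ε ≤ ε₀ →
        NullMeasurableSet (WeightedBergman.badSet p ν S ε f) volume →
        WeightedBergman.IsDominatingFor p ω f
          (WeightedBergman.unitDisc \ WeightedBergman.badSet p ν S ε f)) := by
  obtain ⟨C, hC0, hC⟩ := WeightedBergman.exists_integralOver_badSet_le hω hr₀ hr₁
  -- This `ε₀` is the threshold at which `C ε ≤ 1/2`.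
  refine ⟨⟨C, hC0, hC⟩, 1 / (2 * C), by positivity, fun p hp ν S hS f hf ε hε hε₀ hE => ?_⟩
  refine WeightedBergman.isDominatingFor_diff hf hE ((hC p hp ν S hS f hf ε hε hE).trans ?_)
  gcongr
  rw [le_div_iff₀ (by positivity)] at hε₀
  linarith
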